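/- Let $I=[a,b]\subseteq\mathbb{R}$ be a bounded interval, let $q\ge 1$ and $\alpha\in(1-1/q,1]$, and let $g:I\to\mathbb{R}$ be a function with $g(a)=g(b)$ and finite $q$-variation, i.e. $\sup\big\{\big(\sum_{i=1}^m|g(t_i)-g(t_{i-1})|^q\big)^{1/q} : t_0<t_1<\dots<t_m \text{ in } I\big\}<\infty$. Let $\Gamma_\alpha(g)$ be the set of positive Borel measures $\pi$ on $I\times I$ (not necessarily finite) such that $$\int_{I\times I}|t-s|^\alpha\,\pi(ds,dt)<\infty \qquad\text{and}\qquad \int_{I\times I}\big(f(t)-f(s)\big)\,\pi(ds,dt)=\int_I f\,dg$$ for every $\alpha$-Hölder continuous $f:I\to\mathbb{R}$, where $\int_I f\,dg$ is the Young (Riemann–Stieltjes) integral, i.e. the limit of the sums $\sum_{i=1}^m f(t_{i-1})(g(t_i)-g(t_{i-1}))$ over partitions $a=t_0<\dots<t_m=b$ as the mesh tends to $0$. A coupling $\pi\in\Gamma_\alpha(g)$ is *optimal* if it minimizes $\int_{I\times I}|t-s|^\alpha\,d\pi$ over $\Gamma_\alpha(g)$. A set $\Gamma\subseteq\mathbb{R}\times\mathbb{R}$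 is *$\alpha$-monotone* if for every $n$, every finite family $((s_i,t_i))_{i=1}^n$ in $\Gamma$ and every permutation $\sigma$ of $\{1,\dots,n\}$, $$\sum_{i=1}^n|t_i-s_i|^\alpha\le\sum_{i=1}^n|t_i-s_{\sigma(i)}|^\alpha .$$ **Proposition 4.3 (α-monotonicity of optimal couplings).** Let $\pi\in\Gamma_\alpha(g)$. If $\pi$ is optimal, then its support $\operatorname{supp}\pi$ is $\alpha$-monotone. Conversely, if $\pi$ is concentrated on an $\alpha$-monotone set $\Gamma$ (that is, the complement of $\Gamma$ is $\pi$-null), then $\pi$ is optimal. -/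

import Mathlib

open MeasureTheory Set
open scoped NNReal ENNReal

namespace KantorovichYoung

/-- The `p`-variation semi-norm of `f` on the set `I`: the supremum of
`(∑ |f (t_i) - f (t_{i-1})| ^ p) ^ (1 / p)` over all finite families
`t_0 < t_1 < ... < t_m` of points of `I`. -/
noncomputable def pVariation (p : ℝ) (f : ℝ → ℝ) (I : Set ℝ) : ℝ≥0∞ :=
  ⨆ (m : ℕ) (t : Fin (m + 1) → ℝ) (_ : StrictMono t) (_ : ∀ i, t i ∈ I),
    (∑ i : Fin m, ENNReal.ofReal (|f (t i.succ) - f (t i.castSucc)|) ^ p) ^ (1 / p)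

/-- A partition `a = t_0 < t_1 < ... < t_m = b` of the interval `[a, b]`. -/
structure IntervalPartition (a b : ℝ) where
  /-- the number of subintervals -/
  m : ℕ
  /-- the partition points -/
  pts : Fin (m + 1) → ℝ
  strictMono : StrictMono pts
  first : pts 0 = a
  last : pts (Fin.last m) = b

/-- The Riemann-Stieltjes sum `∑ f (t_{i-1}) (g (t_i) - g (t_{i-1}))`. -/
noncomputable def stieltjesSum {a b : ℝ} (f g : ℝ → ℝ) (P : IntervalPartition a b) : ℝ :=
  ∑ i : Fin P.m, f (P.pts i.castSucc) * (g (P.pts i.succ) - g (P.pts i.castSucc))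

/-- The Riemann-Stieltjes (Young) integral of `f` with respect to `g` over `[a, b]` exists and
equals `L`: the sums over partitions converge to `L` as the mesh of the partition tends to `0`. -/
def HasYoungIntegral (f g : ℝ → ℝ) (a b L : ℝ) : Prop :=
  ∀ ε > 0, ∃ δ > 0, ∀ P : IntervalPartition a b,
    (∀ i : Fin P.m, P.pts i.succ - P.pts i.castSucc < δ) → |stieltjesSum f g P - L| < ε

/-- The energy `∫ |t - s| ^ α dπ(s, t)`, with value in `[0, ∞]`. -/
noncomputable def energy (α : ℝ≥0) (π : Measure (ℝ × ℝ)) : ℝ≥0∞ :=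
  ∫⁻ z, ENNReal.ofReal (|z.2 - z.1| ^ (α : ℝ)) ∂π

/-- The couplings for `g` over `I = [a, b]` with finite `α`-energy: the positive Borel measures
`π` on `I × I` (not necessarily finite; regarded as measures on `ℝ × ℝ` that vanish outside
`I × I`) such that `∫ |t - s| ^ α dπ < ∞` and `∫ (f t - f s) dπ(s, t) = ∫_I f dg` for every
`f` that is Hölder continuous of exponent `α` on `I`. -/
def couplings (α : ℝ≥0) (g : ℝ → ℝ) (a b : ℝ) : Set (Measure (ℝ × ℝ)) :=
  {π | π (Icc a b ×ˢ Icc a b)ᶜ = 0 ∧ energy α π < ∞ ∧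
    ∀ f : ℝ → ℝ, (∃ C : ℝ≥0, HolderOnWith C α f (Icc a b)) →
      HasYoungIntegral f g a b (∫ z, (f z.2 - f z.1) ∂π)}

/-- `π` is a minimizer of the energy among the couplings for `g` with finite `α`-energy. -/
def IsOptimal (α : ℝ≥0) (g : ℝ → ℝ) (a b : ℝ) (π : Measure (ℝ × ℝ)) : Prop :=
  π ∈ couplings α g a b ∧ ∀ π' ∈ couplings α g a b, energy α π ≤ energy α π'

/-- A set `Γ` of pairs `(s, t)` is `α`-monotone if `∑ |t_i - s_i| ^ α ≤ ∑ |t_i - s_{σ i}| ^ α`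
for all finite families `(s_i, t_i)` in `Γ` and all permutations `σ` of the indices. -/
def IsAlphaMonotone (α : ℝ≥0) (Γ : Set (ℝ × ℝ)) : Prop :=
  ∀ (n : ℕ) (z : Fin n → ℝ × ℝ), (∀ i, z i ∈ Γ) → ∀ σ : Equiv.Perm (Fin n),
    ∑ i, |(z i).2 - (z i).1| ^ (α : ℝ) ≤ ∑ i, |(z i).2 - (z (σ i)).1| ^ (α : ℝ)

end KantorovichYoung

namespace KantorovichYoung

/-! For the converse, any `f` that is `α`-Hölder with constant `1` bounds the energy of every
coupling below by `∫ f dg`. This bound is attained when `f t - f s` equals the cost on a set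
carrying `π`. `IsAlphaMonotone.exists_potential` builds such an `f` as an infimum of chain lengths:
`α ≤ 1` makes the cost a metric, hence `f` Hölder, and monotonicity keeps the infimum finite.

For the direct implication, small pieces of `π` near the points `z i` are replaced by products of
their permuted marginals. The constraint sees only the difference of the marginals, so the result is
again a coupling, and optimality compares the energies (`IsOptimal.sum_energy_le`). Shrinking the
neighbourhoods gives the inequality at the points. Since `π` may have infinite mass near the
diagonal, Dirac masses are first added at diagonal points; these are free. -/

/-- The cost `|t - s| ^ α` of moving mass from `s` to `t`. -/
noncomputable def cost (α : ℝ≥0) (s t : ℝ) : ℝ := |t - s| ^ (α : ℝ)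

/-! ### The cost as a metric -/

section Cost

variable {α : ℝ≥0}

lemma cost_nonneg (s t : ℝ) : 0 ≤ cost α s t := by unfold cost; positivity

lemma cost_comm (s t : ℝ) : cost α s t = cost α t s := by simp [cost, abs_sub_comm]

lemma cost_self (hα : 0 < α) (s : ℝ) : cost α s s = 0 := by
  simp [cost, Real.zero_rpow (NNReal.coe_ne_zero.2 hα.ne')]

lemma cost_pos {s t : ℝ} (h : s ≠ t) : 0 < cost α s t :=
  Real.rpow_pos_of_pos (abs_pos.2 (sub_ne_zero.2 h.symm)) _

lemma cost_triangle (hα : α ≤ 1) (x y z : ℝ) : cost α x z ≤ cost α x y + cost α y z := by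
  have hα' : (α : ℝ) ≤ 1 := by exact_mod_cast hα
  have h1 : |z - x| ≤ |y - x| + |z - y| := by
    have := abs_add_le (y - x) (z - y)
    rwa [show y - x + (z - y) = z - x by ring] at this
  exact (Real.rpow_le_rpow (abs_nonneg _) h1 α.2).trans
    (Real.rpow_add_le_add_rpow (abs_nonneg _) (abs_nonneg _) α.2 hα')

lemma continuous_cost : Continuous fun z : ℝ × ℝ => cost α z.1 z.2 := by
  unfold cost
  exact ((continuous_snd.sub continuous_fst).abs).rpow_const fun _ => Or.inr α.2

lemma holderWith_iff_cost {f : ℝ → ℝ} {C : ℝ≥0} :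
    HolderWith C α f ↔ ∀ s t, |f t - f s| ≤ C * cost α s t := by
  have key : ∀ s t, edist (f t) (f s) ≤ C * edist t s ^ (α : ℝ) ↔
      |f t - f s| ≤ C * cost α s t := fun s t => by
    rw [edist_dist, edist_dist, ENNReal.ofReal_rpow_of_nonneg dist_nonneg α.coe_nonneg,
      ← ENNReal.ofReal_coe_nnreal, ← ENNReal.ofReal_mul C.coe_nonneg,
      ENNReal.ofReal_le_ofReal_iff (by positivity), Real.dist_eq, Real.dist_eq]
    rfl
  exact ⟨fun h s t => (key s t).1 (h t s), fun h s t => (key t s).2 (h t s)⟩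

end Cost

/-! ### Potentials of monotone sets -/

section Potential

variable {α : ℝ≥0} {Γ : Set (ℝ × ℝ)}

/-- The length of the chain from `x₀` to `x` through the points `z i`, where moving forwards from
`s` to `t` costs `cost α s t` and each pair `z i = (s, t)` is traversed backwards with a gain of
`cost α s t`. -/
noncomputable def chainLength (α : ℝ≥0) (x₀ : ℝ) (n : ℕ) (z : Fin (n + 1) → ℝ × ℝ) (x : ℝ) : ℝ :=
  cost α x₀ (z 0).2 + ∑ i : Fin n, cost α (z i.castSucc).1 (z i.succ).2 +
    cost α (z (Fin.last n)).1 x - ∑ i, cost α (z i).1 (z i).2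

/-- Monotonicity for the cyclic shift, which sends the source of each pair to the target of the next
one. -/
lemma IsAlphaMonotone.sum_le_cyclic (h : IsAlphaMonotone α Γ) {n : ℕ} {z : Fin (n + 1) → ℝ × ℝ}
    (hz : ∀ i, z i ∈ Γ) :
    ∑ i, cost α (z i).1 (z i).2 ≤
      ∑ i : Fin n, cost α (z i.castSucc).1 (z i.succ).2 + cost α (z (Fin.last n)).1 (z 0).2 := by
  refine (h (n + 1) z hz (finRotate (n + 1)).symm).trans_eq ?_
  rw [← Equiv.sum_comp (finRotate (n + 1)), Fin.sum_univ_castSucc]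
  simp only [Equiv.symm_apply_apply]
  simp only [finRotate_apply, Fin.coeSucc_eq_succ, Fin.last_add_one]
  rfl

/-- Closing the chain into a cycle through `x` and `x₀` costs at most `cost α x x₀` more, and cycles
have nonnegative length. This bound makes the infimum over chains finite. -/
lemma neg_cost_le_chainLength (hα : α ≤ 1) (h : IsAlphaMonotone α Γ) {n : ℕ}
    {z : Fin (n + 1) → ℝ × ℝ} (hz : ∀ i, z i ∈ Γ) (x₀ x : ℝ) :
    -cost α x x₀ ≤ chainLength α x₀ n z x := by
  have h1 := h.sum_le_cyclic hz
  have h2 := cost_triangle hα (z (Fin.last n)).1 x (z 0).2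
  have h3 := cost_triangle hα x x₀ (z 0).2
  unfold chainLength
  linarith

/-- Rockafellar-Rüschendorf for the metric cost `|t - s| ^ α`: an `α`-monotone set lies in the
contact set of a function that is Hölder continuous with constant `1`. -/
theorem IsAlphaMonotone.exists_potential (hα0 : 0 < α) (hα : α ≤ 1) (h : IsAlphaMonotone α Γ) :
    ∃ f : ℝ → ℝ, HolderWith 1 α f ∧ ∀ z ∈ Γ, f z.2 - f z.1 = cost α z.1 z.2 := by
  rcases Γ.eq_empty_or_nonempty with rfl | ⟨w, hw⟩
  · exact ⟨0, holderWith_iff_cost.2 fun s t => by simpa using cost_nonneg s t, by simp⟩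
  let ι := Σ n : ℕ, {z : Fin (n + 1) → ℝ × ℝ // ∀ i, z i ∈ Γ}
  let W : ι → ℝ → ℝ := fun p => chainLength α 0 p.1 p.2.1
  have : Nonempty ι := ⟨⟨0, fun _ => w, fun _ => hw⟩⟩
  have hbdd : ∀ x, BddBelow (range fun p => W p x) := fun x =>
    ⟨-cost α x 0, by rintro _ ⟨p, rfl⟩; exact neg_cost_le_chainLength hα h p.2.2 0 x⟩
  let f : ℝ → ℝ := fun x => ⨅ p, W p x
  have hf : ∀ x y, f y ≤ f x + cost α x y := fun x y => by
    rw [← sub_le_iff_le_add]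
    refine le_ciInf fun p => ?_
    have h1 : f y ≤ W p y := ciInf_le (hbdd y) p
    have h2 := cost_triangle hα (p.2.1 (Fin.last p.1)).1 x y
    simp only [W, chainLength] at h1 ⊢
    linarith
  refine ⟨f, holderWith_iff_cost.2 fun s t => ?_, fun z hz => ?_⟩
  · rw [abs_le]
    have h1 := hf s t
    have h2 := hf t s
    rw [cost_comm t s] at h2
    constructor <;> push_cast <;> linarith
  · refine le_antisymm (by linarith [hf z.1 z.2]) ?_
    suffices f z.1 + cost α z.1 z.2 ≤ f z.2 by linarith
    refine le_ciInf fun p => ?_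
    obtain ⟨n, v, hv⟩ := p
    -- Appending `z` makes the chain end at `z.1`: the last forward move is then free, and `z`
    -- itself contributes its gain.
    let p' : ι := ⟨n + 1, Fin.snoc (α := fun _ => ℝ × ℝ) v z, fun i => by
      refine Fin.lastCases ?_ (fun j => ?_) i
      · simpa using hz
      · simpa using hv j⟩
    have h1 : f z.1 ≤ W p' z.1 := ciInf_le (hbdd _) p'
    have h2 : W p' z.1 = W ⟨n, v, hv⟩ z.2 - cost α z.1 z.2 := by
      have h0 : (Fin.snoc (α := fun _ => ℝ × ℝ) v z : Fin (n + 2) → ℝ × ℝ) 0 = v 0 :=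
        Fin.snoc_castSucc (α := fun _ => ℝ × ℝ) z v 0
      simp only [W, p', chainLength, h0]
      rw [Fin.sum_univ_castSucc (n := n), Fin.sum_univ_castSucc (n := n + 1)]
      simp only [← Fin.castSucc_succ, Fin.succ_last, Fin.snoc_castSucc, Fin.snoc_last,
        cost_self hα0]
      ring
    linarith

end Potential

/-! ### Uniqueness of the Young integral -/

section Young

variable {a b : ℝ}

lemma exists_intervalPartition_mesh_lt (hab : a ≤ b) {δ : ℝ} (hδ : 0 < δ) :
    ∃ P : IntervalPartition a b, ∀ i : Fin P.m, P.pts i.succ - P.pts i.castSucc < δ := by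
  rcases hab.eq_or_lt with rfl | hab
  · exact ⟨⟨0, fun _ => a, (Fin.strictMono_iff_lt_succ).2 fun i => i.elim0, rfl, rfl⟩, fun i => i.elim0⟩
  obtain ⟨n, hn⟩ := exists_nat_gt ((b - a) / δ)
  have hn0 : (0 : ℝ) < n := lt_trans (div_pos (sub_pos.2 hab) hδ) hn
  have hd : 0 < (b - a) / n := div_pos (sub_pos.2 hab) hn0
  refine ⟨⟨n, fun i => a + i * ((b - a) / n), fun i j hij => ?_, by simp, ?_⟩, fun i => ?_⟩
  · have : (i : ℝ) < j := by exact_mod_cast hij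
    simpa using mul_lt_mul_of_pos_right this hd
  · simp only [Fin.val_last]
    field_simp
    ring
  · have : (b - a) / n < δ := by
      rw [div_lt_iff₀ hδ] at hn
      rw [div_lt_iff₀ hn0]
      linarith
    simp only [Fin.val_succ, Fin.val_castSucc]
    push_cast
    linarith

lemma HasYoungIntegral.unique (hab : a ≤ b) {f g : ℝ → ℝ} {L L' : ℝ}
    (h : HasYoungIntegral f g a b L) (h' : HasYoungIntegral f g a b L') : L = L' := by
  refine eq_of_forall_dist_le fun ε hε => ?_
  obtain ⟨δ, hδ, H⟩ := h (ε / 2) (half_pos hε)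
  obtain ⟨δ', hδ', H'⟩ := h' (ε / 2) (half_pos hε)
  obtain ⟨P, hP⟩ := exists_intervalPartition_mesh_lt hab (lt_min hδ hδ')
  have h1 := H P fun i => (hP i).trans_le (min_le_left _ _)
  have h2 := H' P fun i => (hP i).trans_le (min_le_right _ _)
  rw [Real.dist_eq]
  rw [abs_sub_comm] at h1
  have := abs_sub_le L (stieltjesSum f g P) L'
  linarith

end Young

/-! ### Energy and integrability -/

section Energy

variable {α : ℝ≥0} {ρ ρ' : Measure (ℝ × ℝ)}

lemma energy_eq_lintegral_cost (α : ℝ≥0) (ρ : Measure (ℝ × ℝ)) :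
    energy α ρ = ∫⁻ z, ENNReal.ofReal (cost α z.1 z.2) ∂ρ := rfl

lemma energy_add (α : ℝ≥0) (ρ ρ' : Measure (ℝ × ℝ)) :
    energy α (ρ + ρ') = energy α ρ + energy α ρ' := lintegral_add_measure _ _ _

lemma energy_smul (α c : ℝ≥0) (ρ : Measure (ℝ × ℝ)) : energy α (c • ρ) = c * energy α ρ :=
  lintegral_smul_measure _ _

lemma energy_sum (α : ℝ≥0) {ι : Type*} [Fintype ι] (μ : ι → Measure (ℝ × ℝ)) :
    energy α (∑ i, μ i) = ∑ i, energy α (μ i) := lintegral_finsetSum_measure _ _ _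

lemma energy_eq_zero_of_diagonal (hα : 0 < α) (hρ : ∀ᵐ z ∂ρ, z.1 = z.2) : energy α ρ = 0 := by
  rw [energy_eq_lintegral_cost, lintegral_congr_ae (g := fun _ => 0), lintegral_zero]
  filter_upwards [hρ] with z hz
  simp [hz, cost_self hα]

lemma le_energy [IsProbabilityMeasure ρ] {c : ℝ} (h : ∀ᵐ z ∂ρ, c ≤ cost α z.1 z.2) :
    ENNReal.ofReal c ≤ energy α ρ := by
  calc ENNReal.ofReal c = ∫⁻ _, ENNReal.ofReal c ∂ρ := by simp
    _ ≤ _ := lintegral_mono_ae (h.mono fun z hz => ENNReal.ofReal_le_ofReal hz)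

lemma energy_le [IsProbabilityMeasure ρ] {c : ℝ} (h : ∀ᵐ z ∂ρ, cost α z.1 z.2 ≤ c) :
    energy α ρ ≤ ENNReal.ofReal c := by
  calc energy α ρ ≤ ∫⁻ _, ENNReal.ofReal c ∂ρ :=
        lintegral_mono_ae (h.mono fun z hz => ENNReal.ofReal_le_ofReal hz)
    _ = _ := by simp

lemma integrable_cost (hρ : energy α ρ < ∞) : Integrable (fun z => cost α z.1 z.2) ρ :=
  ⟨continuous_cost.aestronglyMeasurable,
    (hasFiniteIntegral_iff_ofReal (.of_forall fun _ => cost_nonneg _ _)).2 hρ⟩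

lemma energy_eq_ofReal_integral (hρ : energy α ρ < ∞) :
    energy α ρ = ENNReal.ofReal (∫ z, cost α z.1 z.2 ∂ρ) :=
  (ofReal_integral_eq_lintegral_ofReal (integrable_cost hρ)
    (.of_forall fun _ => cost_nonneg _ _)).symm

lemma integrable_holderWith (hα : 0 < α) {F : ℝ → ℝ} {C : ℝ≥0} (hF : HolderWith C α F)
    (hρ : energy α ρ < ∞) : Integrable (fun z : ℝ × ℝ => F z.2 - F z.1) ρ := by
  have hc := hF.continuous hα
  exact ((integrable_cost hρ).const_mul C).mono' (by fun_prop)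
    (.of_forall fun z => holderWith_iff_cost.1 hF z.1 z.2)

end Energy

/-! ### Couplings, and optimality from monotonicity -/

section Couplings

variable {α : ℝ≥0} {g : ℝ → ℝ} {a b : ℝ} {π ρ : Measure (ℝ × ℝ)}

/-- Precomposing with the `1`-Lipschitz projection onto the interval keeps the Hölder constant. -/
lemma exists_holderWith_extension (hab : a ≤ b) {f : ℝ → ℝ} {C : ℝ≥0}
    (hf : HolderOnWith C α f (Icc a b)) :
    ∃ F : ℝ → ℝ, HolderWith C α F ∧ EqOn F f (Icc a b) := by
  refine ⟨fun x => f (projIcc a b hab x), fun x y => ?_, fun x hx => by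
    simp [projIcc_of_mem hab hx]⟩
  refine (hf _ (projIcc a b hab x).2 _ (projIcc a b hab y).2).trans ?_
  gcongr
  simpa [Subtype.edist_eq] using (LipschitzWith.projIcc hab) x y

lemma ae_mem_Icc (hρ : ρ (Icc a b ×ˢ Icc a b)ᶜ = 0) :
    ∀ᵐ z ∂ρ, z.1 ∈ Icc a b ∧ z.2 ∈ Icc a b := by
  filter_upwards [show (Icc a b ×ˢ Icc a b) ∈ ae ρ from hρ] with z hz using hz

lemma mem_couplings_of_integral_eq (hab : a ≤ b) (hπ : π ∈ couplings α g a b)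
    (hρ : ρ (Icc a b ×ˢ Icc a b)ᶜ = 0) (hρE : energy α ρ < ∞)
    (h : ∀ (F : ℝ → ℝ) (C : ℝ≥0), HolderWith C α F →
      ∫ z, (F z.2 - F z.1) ∂ρ = ∫ z, (F z.2 - F z.1) ∂π) : ρ ∈ couplings α g a b := by
  refine ⟨hρ, hρE, fun f ⟨C, hf⟩ => ?_⟩
  obtain ⟨F, hF, hFf⟩ := exists_holderWith_extension hab hf
  have key : ∀ μ : Measure (ℝ × ℝ), μ (Icc a b ×ˢ Icc a b)ᶜ = 0 →
      ∫ z, (F z.2 - F z.1) ∂μ = ∫ z, (f z.2 - f z.1) ∂μ := fun μ hμ =>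
    integral_congr_ae ((ae_mem_Icc hμ).mono fun z hz => by simp only [hFf hz.1, hFf hz.2])
  rw [← key ρ hρ, h F C hF, key π hπ.1]
  exact hπ.2.2 f ⟨C, hf⟩

/-- Mass on the diagonal is invisible to the constraint and to the energy. -/
lemma IsOptimal.add_diagonal (hab : a ≤ b) (hα : 0 < α) (hπ : IsOptimal α g a b π)
    (hρ : ρ (Icc a b ×ˢ Icc a b)ᶜ = 0) (hd : ∀ᵐ z ∂ρ, z.1 = z.2) :
    IsOptimal α g a b (π + ρ) := by
  have hρE := energy_eq_zero_of_diagonal hα hd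
  have hE : energy α (π + ρ) = energy α π := by rw [energy_add, hρE, add_zero]
  refine ⟨mem_couplings_of_integral_eq hab hπ.1 (by simp [-Icc_prod_Icc, hπ.1.1, hρ]) (hE ▸ hπ.1.2.1)
    fun F C hF => ?_, fun π' hπ' => hE ▸ hπ.2 π' hπ'⟩
  rw [integral_add_measure (integrable_holderWith hα hF hπ.1.2.1)
    (integrable_holderWith hα hF (by simp [hρE])), add_eq_left]
  exact integral_eq_zero_of_ae (hd.mono fun z hz => by simp [hz])

/-- A coupling concentrated on an `α`-monotone set is optimal. -/
theorem IsAlphaMonotone.isOptimal (hab : a ≤ b) (hα0 : 0 < α) (hα : α ≤ 1)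
    {Γ : Set (ℝ × ℝ)} (hΓ : IsAlphaMonotone α Γ) (hπ : π ∈ couplings α g a b) (hπΓ : π Γᶜ = 0) :
    IsOptimal α g a b π := by
  refine ⟨hπ, fun π' hπ' => ?_⟩
  obtain ⟨f, hf, hfΓ⟩ := hΓ.exists_potential hα0 hα
  have hfI : ∃ C : ℝ≥0, HolderOnWith C α f (Icc a b) := ⟨1, hf.holderOnWith _⟩
  rw [energy_eq_ofReal_integral hπ.2.1, energy_eq_ofReal_integral hπ'.2.1]
  refine ENNReal.ofReal_le_ofReal ?_
  calc ∫ z, cost α z.1 z.2 ∂π = ∫ z, (f z.2 - f z.1) ∂π := integral_congr_ae <| by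
        filter_upwards [show Γ ∈ ae π from hπΓ] with z hz using (hfΓ z hz).symm
    _ = ∫ z, (f z.2 - f z.1) ∂π' := (hπ.2.2 f hfI).unique hab (hπ'.2.2 f hfI)
    _ ≤ ∫ z, cost α z.1 z.2 ∂π' :=
        integral_mono (integrable_holderWith hα0 hf hπ'.2.1) (integrable_cost hπ'.2.1) fun z => by
          simpa using (le_abs_self _).trans (holderWith_iff_cost.1 hf z.1 z.2)

end Couplings

/-! ### Rearranging an optimal coupling -/

section Recouple

variable {α : ℝ≥0} {g : ℝ → ℝ} {a b : ℝ} {π : Measure (ℝ × ℝ)}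

lemma ae_fst_prod_snd {μ ν : Measure (ℝ × ℝ)} [IsProbabilityMeasure μ] [IsProbabilityMeasure ν]
    {A B : Set ℝ} (hA : MeasurableSet A) (hB : MeasurableSet B) (hμ : ∀ᵐ z ∂μ, z.1 ∈ A)
    (hν : ∀ᵐ z ∂ν, z.2 ∈ B) : ∀ᵐ z ∂(μ.fst.prod ν.snd), z.1 ∈ A ∧ z.2 ∈ B := by
  have h1 : ∀ᵐ x ∂μ.fst, x ∈ A := (ae_map_iff measurable_fst.aemeasurable hA).2 hμ
  have h2 : ∀ᵐ x ∂ν.snd, x ∈ B := (ae_map_iff measurable_snd.aemeasurable hB).2 hν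
  exact (Measure.quasiMeasurePreserving_fst.ae h1).and (Measure.quasiMeasurePreserving_snd.ae h2)

lemma integral_sub_fst_prod_snd {μ ν : Measure (ℝ × ℝ)} [IsProbabilityMeasure μ]
    [IsProbabilityMeasure ν] {F : ℝ → ℝ} (hF : Continuous F)
    (hμ : Integrable (fun z => F z.1) μ) (hν : Integrable (fun z => F z.2) ν) :
    ∫ z, (F z.2 - F z.1) ∂(μ.fst.prod ν.snd) = ∫ z, F z.2 ∂ν - ∫ z, F z.1 ∂μ := by
  have h1 : Integrable F μ.fst :=
    (integrable_map_measure hF.aestronglyMeasurable measurable_fst.aemeasurable).2 hμ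
  have h2 : Integrable F ν.snd :=
    (integrable_map_measure hF.aestronglyMeasurable measurable_snd.aemeasurable).2 hν
  rw [integral_sub (h2.comp_snd _) (h1.comp_fst _), integral_fun_snd, integral_fun_fst,
    Measure.fst, Measure.snd, integral_map measurable_fst.aemeasurable hF.aestronglyMeasurable,
    integral_map measurable_snd.aemeasurable hF.aestronglyMeasurable]
  simp [Measure.map_apply measurable_fst, Measure.map_apply measurable_snd, Measure.real]

lemma integrable_comp_of_continuous {μ : Measure (ℝ × ℝ)} [IsProbabilityMeasure μ]
    (hμ : μ (Icc a b ×ˢ Icc a b)ᶜ = 0) {G : ℝ × ℝ → ℝ} (hG : Continuous G) : Integrable G μ := by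
  obtain ⟨M, hM⟩ := (isCompact_Icc.prod isCompact_Icc).exists_bound_of_continuousOn
    (s := Icc a b ×ˢ Icc a b) hG.continuousOn
  exact .of_bound hG.aestronglyMeasurable M ((ae_mem_Icc hμ).mono fun z hz => hM z hz)

/-- Rearranging finitely many pieces of an optimal coupling does not decrease the energy. -/
theorem IsOptimal.sum_energy_le (hab : a ≤ b) (hα : 0 < α) (hπ : IsOptimal α g a b π) {n : ℕ}
    (μ : Fin n → Measure (ℝ × ℝ)) [∀ i, IsProbabilityMeasure (μ i)]
    (hμ : ∀ i, μ i (Icc a b ×ˢ Icc a b)ᶜ = 0) (M : Fin n → ℝ≥0) (hM : ∀ i, μ i ≤ M i • π)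
    (σ : Equiv.Perm (Fin n)) :
    ∑ i, energy α (μ i) ≤ ∑ i, energy α ((μ (σ i)).fst.prod (μ i).snd) := by
  set ν : Fin n → Measure (ℝ × ℝ) := fun i => (μ (σ i)).fst.prod (μ i).snd
  -- Small enough that all the pieces can be removed from `π` at once; the `+ 1` covers an empty
  -- family.
  set ε : ℝ≥0 := (∑ i, M i + 1)⁻¹
  have hε : 0 < ε := by positivity
  have hε1 : ε * ∑ i, M i ≤ 1 := by
    rw [inv_mul_le_iff₀ (by positivity)]
    simp
  have hle : ε • ∑ i, μ i ≤ π := by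
    calc ε • ∑ i, μ i ≤ ε • ∑ i, M i • π := by gcongr with i; exact hM i
      _ = (ε * ∑ i, M i) • π := by rw [← Finset.sum_smul, smul_smul]
      _ ≤ (1 : ℝ≥0) • π := by gcongr
      _ = π := one_smul _ _
  have hνK : ∀ i, ν i (Icc a b ×ˢ Icc a b)ᶜ = 0 := fun i =>
    ae_fst_prod_snd measurableSet_Icc measurableSet_Icc ((ae_mem_Icc (hμ _)).mono fun z hz => hz.1)
      ((ae_mem_Icc (hμ _)).mono fun z hz => hz.2)
  rcases eq_or_ne (∑ i, energy α (ν i)) ∞ with htop | htop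
  · rw [htop]; exact le_top
  set A := π - ε • ∑ i, μ i
  have hA : A + ε • ∑ i, μ i = π := Measure.sub_add_cancel_of_le hle
  have hπE : energy α A + ε * ∑ i, energy α (μ i) = energy α π := by
    rw [← energy_sum, ← energy_smul, ← energy_add, hA]
  have hfin : energy α A + ε * ∑ i, energy α (μ i) < ∞ := hπE ▸ hπ.1.2.1
  have hAE : energy α A < ∞ := (ENNReal.add_lt_top.1 hfin).1
  have hρE : energy α (A + ε • ∑ i, ν i) = energy α A + ε * ∑ i, energy α (ν i) := by
    rw [energy_add, energy_smul, energy_sum]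
  have hμi : ∀ i, energy α (μ i) < ∞ := fun i => by
    rw [energy_eq_lintegral_cost]
    exact (integrable_comp_of_continuous (hμ i) continuous_cost).lintegral_lt_top
  have hνi : ∀ i, energy α (ν i) < ∞ := fun i =>
    (ENNReal.sum_ne_top.1 htop i (Finset.mem_univ i)).lt_top
  have hρ : A + ε • ∑ i, ν i ∈ couplings α g a b := by
    refine mem_couplings_of_integral_eq hab hπ.1 ?_ ?_ fun F C hF => ?_
    · have : A (Icc a b ×ˢ Icc a b)ᶜ = 0 := Measure.absolutelyContinuous_of_le Measure.sub_le hπ.1.1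
      simp [-Icc_prod_Icc, this, hνK]
    · rw [hρE]
      exact ENNReal.add_lt_top.2 ⟨hAE, ENNReal.mul_lt_top (by simp) htop.lt_top⟩
    · have hsum : ∀ m : Fin n → Measure (ℝ × ℝ), (∀ i, energy α (m i) < ∞) →
          ∫ z, (F z.2 - F z.1) ∂(A + ε • ∑ i, m i) =
            ∫ z, (F z.2 - F z.1) ∂A + ε * ∑ i, ∫ z, (F z.2 - F z.1) ∂(m i) := fun m hm => by
        have hi := fun i => integrable_holderWith hα hF (hm i)
        rw [integral_add_measure (integrable_holderWith hα hF hAE)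
          ((integrable_finsetSum_measure.2 fun i _ => hi i).smul_measure_nnreal),
          integral_smul_nnreal_measure, integral_finsetSum_measure fun i _ => hi i]
        rfl
      have hc := hF.continuous hα
      have h1 : ∀ i, Integrable (fun z => F z.1) (μ i) := fun i =>
        integrable_comp_of_continuous (hμ i) (hc.comp continuous_fst)
      have h2 : ∀ i, Integrable (fun z => F z.2) (μ i) := fun i =>
        integrable_comp_of_continuous (hμ i) (hc.comp continuous_snd)
      rw [hsum ν hνi, ← hA, hsum μ hμi]
      congr 2
      -- Both sides depend only on the marginals, and `σ` merely reindexes the first ones.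
      simp only [ν, integral_sub_fst_prod_snd hc (h1 _) (h2 _), integral_sub (h2 _) (h1 _),
        Finset.sum_sub_distrib]
      rw [Equiv.sum_comp σ fun i => ∫ z, F z.1 ∂μ i]
  have := hπ.2 _ hρ
  rw [hρE, ← hπE, ENNReal.add_le_add_iff_left hAE.ne] at this
  exact (ENNReal.mul_le_mul_iff_right (by simpa using hε.ne') (by simp)).1 this

/-- Near an off-diagonal point of its support, a measure of finite energy has a normalized
restriction. -/
lemma exists_probability_le_smul (hπ : energy α π < ∞) {z : ℝ × ℝ} (hz : z ∈ π.support)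
    (hne : z.1 ≠ z.2) {U : Set (ℝ × ℝ)} (hU : U ∈ nhds z) :
    ∃ μ : Measure (ℝ × ℝ), IsProbabilityMeasure μ ∧ μ Uᶜ = 0 ∧ ∃ M : ℝ≥0, μ ≤ M • π := by
  obtain ⟨V, hVU, hV, hzV⟩ := mem_nhds_iff.1 hU
  -- Staying where the cost is bounded below gives `W` finite mass by Markov's inequality.
  set W := V ∩ {w | cost α z.1 z.2 / 2 < cost α w.1 w.2}
  have hW : IsOpen W := hV.inter (isOpen_lt continuous_const continuous_cost)
  have hc := cost_pos (α := α) hne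
  have hpos : 0 < π W :=
    Measure.mem_support_iff_forall z |>.1 hz W (hW.mem_nhds ⟨hzV, half_lt_self hc⟩)
  have hfin : π W ≠ ∞ := by
    refine measure_ne_top_of_subset (s := {w : ℝ × ℝ | ENNReal.ofReal (cost α z.1 z.2 / 2) ≤
      ENNReal.ofReal (cost α w.1 w.2)}) (fun w hw => ENNReal.ofReal_le_ofReal (le_of_lt hw.2)) ?_
    have := mul_meas_ge_le_lintegral (μ := π) (continuous_cost (α := α)).measurable.ennreal_ofReal
      (ENNReal.ofReal (cost α z.1 z.2 / 2))
    intro htop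
    rw [htop, ENNReal.mul_top (by simpa using hc)] at this
    exact hπ.ne (top_le_iff.1 this)
  refine ⟨(π W)⁻¹ • π.restrict W, ⟨?_⟩, ?_, ((π W)⁻¹).toNNReal, ?_⟩
  · simp [ENNReal.inv_mul_cancel hpos.ne' hfin]
  · have : π.restrict W Uᶜ = 0 := by
      rw [Measure.restrict_apply₀' hW.measurableSet.nullMeasurableSet,
        (disjoint_compl_left.mono_right (inter_subset_left.trans hVU)).inter_eq, measure_empty]
    simp [this]
  · refine Measure.le_iff.2 fun s _ => ?_
    simp only [Measure.smul_apply, smul_eq_mul, ENNReal.smul_def,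
      ENNReal.coe_toNNReal (ENNReal.inv_ne_top.2 hpos.ne')]
    gcongr
    exact Measure.restrict_le_self

/-- The support of an optimal coupling is `α`-monotone. -/
theorem IsOptimal.isAlphaMonotone_support (hab : a ≤ b) (hα : 0 < α)
    (hπ : IsOptimal α g a b π) : IsAlphaMonotone α π.support := by
  intro n z hz σ
  change ∑ i, cost α (z i).1 (z i).2 ≤ ∑ i, cost α (z (σ i)).1 (z i).2
  have hzK : ∀ i, z i ∈ Icc a b ×ˢ Icc a b := fun i =>
    Measure.support_subset_of_isClosed (isClosed_Icc.prod isClosed_Icc) hπ.1.1 (hz i)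
  -- Each index loses one `η` on either side of the comparison, hence the factor `n * 2`.
  suffices ∀ η > 0, ∑ i, cost α (z i).1 (z i).2 ≤
      ∑ i, cost α (z (σ i)).1 (z i).2 + (n * 2) * η by
    refine le_of_forall_pos_le_add fun ε hε => ?_
    refine (this (ε / (n * 2 + 1)) (by positivity)).trans ?_
    gcongr
    rw [mul_div_assoc', div_le_iff₀ (by positivity)]
    linarith
  intro η hη
  have hbox : ∀ i, ∃ A B : Set ℝ, IsOpen A ∧ (z (σ i)).1 ∈ A ∧ IsOpen B ∧ (z i).2 ∈ B ∧
      A ×ˢ B ⊆ {w | cost α w.1 w.2 < cost α (z (σ i)).1 (z i).2 + η} := fun i => by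
    refine mem_nhds_prod_iff'.1 ((isOpen_lt continuous_cost continuous_const).mem_nhds ?_)
    simpa using hη
  choose A B hA hzA hB hzB hAB using hbox
  -- The source of `z i` is used by the rearranged pair of index `σ.symm i`, the target by that of
  -- index `i`.
  let U : Fin n → Set (ℝ × ℝ) := fun i =>
    A (σ.symm i) ×ˢ B i ∩ {w | cost α (z i).1 (z i).2 - η < cost α w.1 w.2}
  have hU : ∀ i, U i ∈ nhds (z i) := fun i => by
    refine ((((hA _).prod (hB i))).inter (isOpen_lt continuous_const continuous_cost)).mem_nhds
      ⟨⟨?_, hzB i⟩, by simpa using hη⟩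
    simpa using hzA (σ.symm i)
  set ρ : Measure (ℝ × ℝ) := ∑ i, Measure.dirac ((z i).1, (z i).1)
  have hopt : IsOptimal α g a b (π + ρ) := by
    refine hπ.add_diagonal hab hα ?_ ?_
    · simpa [ρ] using fun i => (hzK i).1
    · have hm : MeasurableSet {w : ℝ × ℝ | w.1 = w.2} :=
        measurableSet_eq_fun measurable_fst measurable_snd
      rw [ae_iff]
      simp [ρ, Measure.dirac_apply' _ hm.compl, ← compl_ofPred]
  have hex : ∀ i, ∃ μ : Measure (ℝ × ℝ), IsProbabilityMeasure μ ∧ μ (U i)ᶜ = 0 ∧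
      ∃ M : ℝ≥0, μ ≤ M • (π + ρ) := fun i => by
    by_cases hd : (z i).1 = (z i).2
    · have he : z i = ((z i).1, (z i).1) := Prod.ext rfl hd.symm
      refine ⟨Measure.dirac (z i), inferInstance, ?_, 1, ?_⟩
      · change U i ∈ ae (Measure.dirac (z i))
        rw [ae_dirac_eq]
        exact Filter.mem_pure.2 (mem_of_mem_nhds (hU i))
      · rw [one_smul]
        refine le_trans ?_ (le_add_of_nonneg_left (Measure.zero_le π))
        conv_lhs => rw [he]
        exact Finset.single_le_sum (f := fun i => Measure.dirac ((z i).1, (z i).1))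
          (fun _ _ => Measure.zero_le _) (Finset.mem_univ i)
    · refine exists_probability_le_smul hopt.1.2.1 ?_ hd (hU i)
      exact Measure.support_mono (le_add_of_nonneg_right (Measure.zero_le ρ)) (hz i)
  choose μ hμp hμU M hM using hex
  have hμK : ∀ i, μ i (Icc a b ×ˢ Icc a b)ᶜ = 0 := fun i =>
    le_antisymm ((hM i _).trans (by rw [Measure.smul_apply, hopt.1.1, smul_zero])) bot_le
  have hμU' : ∀ i, ∀ᵐ w ∂μ i, w ∈ U i := hμU
  -- The maximum with `0` lets `ENNReal.ofReal` commute with the sum.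
  have h1 : ∀ i, ENNReal.ofReal (max (cost α (z i).1 (z i).2 - η) 0) ≤ energy α (μ i) :=
    fun i => le_energy ((hμU' i).mono fun w hw => max_le hw.2.le (cost_nonneg _ _))
  have h2 : ∀ i, energy α ((μ (σ i)).fst.prod (μ i).snd) ≤
      ENNReal.ofReal (cost α (z (σ i)).1 (z i).2 + η) := fun i =>
    energy_le <| (ae_fst_prod_snd (hA i).measurableSet (hB i).measurableSet
      ((hμU' (σ i)).mono fun w hw => by simpa using hw.1.1)
      ((hμU' i).mono fun w hw => hw.1.2)).mono fun w hw => (hAB i hw).le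
  have h3 := ((Finset.sum_le_sum fun i _ => h1 i).trans
    (hopt.sum_energy_le hab hα μ hμK M hM σ)).trans (Finset.sum_le_sum fun i _ => h2 i)
  have h4 : ∀ i, 0 ≤ cost α (z (σ i)).1 (z i).2 + η := fun i => add_nonneg (cost_nonneg _ _) hη.le
  rw [← ENNReal.ofReal_sum_of_nonneg fun _ _ => le_max_right _ _,
    ← ENNReal.ofReal_sum_of_nonneg fun i _ => h4 i,
    ENNReal.ofReal_le_ofReal_iff (Finset.sum_nonneg fun i _ => h4 i)] at h3
  have h5 := (Finset.sum_le_sum fun i (_ : i ∈ Finset.univ) =>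
    le_max_left (cost α (z i).1 (z i).2 - η) 0).trans h3
  simp only [Finset.sum_sub_distrib, Finset.sum_add_distrib, Finset.sum_const, Finset.card_univ,
    Fintype.card_fin, nsmul_eq_mul] at h5
  linarith

end Recouple

end KantorovichYoung

theorem proposition4p3 (a b : ℝ) (hab : a ≤ b) (q : ℝ) (hq : 1 ≤ q)
    (α : ℝ≥0) (hα : 1 - 1 / q < (α : ℝ)) (hα' : α ≤ 1)
    (g : ℝ → ℝ) (hgvar : KantorovichYoung.pVariation q g (Icc a b) < ∞) (hgab : g a = g b)
    (π : Measure (ℝ × ℝ)) (hπ : π ∈ KantorovichYoung.couplings α g a b) :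
    (KantorovichYoung.IsOptimal α g a b π →
      KantorovichYoung.IsAlphaMonotone α π.support) ∧
    (∀ Γ : Set (ℝ × ℝ), KantorovichYoung.IsAlphaMonotone α Γ → π Γᶜ = 0 →
      KantorovichYoung.IsOptimal α g a b π) := by
  have hα0 : 0 < α := by
    have h1 : 1 / q ≤ 1 := (div_le_one (by linarith)).2 hq
    exact_mod_cast (sub_nonneg.2 h1).trans_lt hα
  exact ⟨fun h => h.isAlphaMonotone_support hab hα0,
    fun Γ hΓ hπΓ => hΓ.isOptimal hab hα0 hα' hπ hπΓ⟩
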